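/- Let $G$ be a finite group, let $p$ be a prime, and let $N$ be a non-abelian normal $p$-subgroup of $G$ that is minimal among the normal subgroups of $G$ not contained in $Z(G)$. Then the following hold. (i) One has $[N,N]\le Z(N)$, and if $\varphi\in\mathrm{Irr}(Z(N))$ is a complex irreducible character that is nontrivial on $[N,N]$ (that is, $\varphi(z)\neq 1$ for some $z\in[N,N]$), then $\varphi$ is fully ramified with respect to $N/Z(N)$; i.e. the induced character satisfies $\varphi^{N}=e\theta$ for some complex irreducible character $\theta\in\mathrm{Irr}(N)$ and some positive integer $e$ with $e^2=|N/Z(N)|$. (ii) If $p>2$, then $G/Z(N)$ splits over $N/Z(N)$, i.e. $N/Z(N)$ has a complement in $G/Z(N)$. Moreover, $N$ is not contained in the Frattini subgroup $\Phi(G)$, the intersection of all maximal subgroups of $G$. -/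

import Mathlib

/-- `χ` is a complex irreducible character of `H`, i.e. `χ ∈ Irr(H)`: the trace of an irreducible
finite-dimensional complex representation (realized, without loss of generality, on `ℂⁿ`). -/
def IsIrrChar {H : Type*} [Group H] (χ : H → ℂ) : Prop :=
  ∃ (n : ℕ) (ρ : Representation ℂ H (Fin n → ℂ)), ρ.IsIrreducible ∧ ρ.character = χ

open Classical in
/-- The induced class function `φ^H` of a class function `φ` of a subgroup `K` of the finite
group `H`: `φ^H(g) = |K|⁻¹ ∑_{x ∈ H} φ°(x⁻¹ g x)`, where `φ°` is `φ` extended by zero. -/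
noncomputable def inducedClassFun {H : Type*} [Group H] [Finite H] (K : Subgroup H)
    (φ : K → ℂ) : H → ℂ := fun g =>
  (Nat.card K : ℂ)⁻¹ *
    ∑ᶠ x : H, if h : x⁻¹ * g * x ∈ K then φ ⟨x⁻¹ * g * x, h⟩ else 0

/-- A character `φ` of a subgroup `K` of `H` is fully ramified with respect to `H/K`:
`φ^H = e θ` with `θ ∈ Irr(H)` and `e² = |H : K|`. -/
def IsFullyRamified {H : Type*} [Group H] [Finite H] (K : Subgroup H) (φ : K → ℂ) : Prop :=
  ∃ (e : ℕ) (θ : H → ℂ), IsIrrChar θ ∧ e ^ 2 = K.index ∧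
    ∀ g : H, inducedClassFun K φ g = (e : ℂ) * θ g

/-- The group `H` splits over its subgroup `M`: there is a subgroup `C` with `M C = H` and
`M ∩ C = 1`. -/
def SplitsOver {H : Type*} [Group H] (M : Subgroup H) : Prop :=
  ∃ C : Subgroup H, Subgroup.IsComplement' M C

/-! By minimality, a subgroup of N invariant under G is central in G or equal to N
(`le_center_or_eq_top_of_minimal`). For Z(N), [N,N] and the radical of the pairing φ[x,y] this gives
Z(N) ≤ Z(G), class two, and nondegeneracy when φ is nontrivial on [N,N]. An irreducible character of
N over φ then vanishes off Z(N); having norm one, its degree squared is |N : Z(N)|.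

For odd p, Baer's twisted product makes N abelian, and φ extends to a character f of the twisted
group (`exists_baer_extension`). The G-conjugates of f differ from f by characters of N/Z(N), and by
nondegeneracy each of these is φ[n,·], the effect of conjugating by some n in N. A Frattini argument
then shows that the stabilizer S of f satisfies NS = G and S ∩ N = Z(N), so S/Z(N) is the
complement. If N ≤ Φ(G), then S = G, so N = Z(N) is central, a contradiction. -/

/-! ### The bilinear commutator map in class two. -/

section CentralCommutator

open Subgroup
open scoped IsMulCommutative

variable {H : Type*} [Group H] (hc : commutator H ≤ center H)

/-- The commutator of two elements of a group of nilpotency class at most two, as an element of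
the center. -/
def centralComm (x y : H) : center H :=
  ⟨x * y * x⁻¹ * y⁻¹, hc (commutator_mem_commutator (mem_top x) (mem_top y))⟩

theorem coe_centralComm (x y : H) : (centralComm hc x y : H) = x * y * x⁻¹ * y⁻¹ := rfl

theorem centralComm_mul_swap (x y : H) : (centralComm hc x y : H) * (y * x) = x * y := by
  rw [coe_centralComm]; group

theorem center_coe_mul_comm (z : center H) (x : H) : (z : H) * x = x * z :=
  (mem_center_iff.1 z.2 x).symm

theorem centralComm_mul_left (x y w : H) :
    centralComm hc (x * y) w = centralComm hc x w * centralComm hc y w := by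
  apply Subtype.ext
  apply mul_right_cancel (b := w * (x * y))
  rw [centralComm_mul_swap, Subgroup.coe_mul]
  calc x * y * w = x * (centralComm hc y w * (w * y)) := by
        rw [centralComm_mul_swap, mul_assoc]
    _ = centralComm hc y w * (x * w) * y := by
        rw [← mul_assoc, ← center_coe_mul_comm]; simp only [mul_assoc]
    _ = centralComm hc y w * (centralComm hc x w * (w * x)) * y := by
        rw [centralComm_mul_swap]
    _ = _ := by
        rw [← mul_assoc, center_coe_mul_comm (centralComm hc y w) (centralComm hc x w : H)]
        simp only [mul_assoc]

theorem centralComm_swap (x y : H) : centralComm hc y x = (centralComm hc x y)⁻¹ := by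
  apply Subtype.ext
  simp only [Subgroup.coe_inv, coe_centralComm]; group

theorem centralComm_mul_right (x y w : H) :
    centralComm hc x (y * w) = centralComm hc x y * centralComm hc x w := by
  rw [centralComm_swap, centralComm_mul_left, centralComm_swap hc x y, centralComm_swap hc x w,
    mul_inv_rev, inv_inv, inv_inv, mul_comm]

theorem centralComm_coe_right (x : H) (z : center H) : centralComm hc x z = 1 := by
  apply Subtype.ext
  rw [coe_centralComm, ← center_coe_mul_comm z x]; simp

theorem centralComm_coe_left (x : H) (z : center H) : centralComm hc z x = 1 := by
  rw [centralComm_swap, centralComm_coe_right, inv_one]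

theorem centralComm_inv_right (x : H) : centralComm hc x x⁻¹ = 1 := by
  apply Subtype.ext
  simp [coe_centralComm]

theorem centralComm_apply_mulAut (α : MulAut H) (hα : ∀ z : center H, α z = z) (x y : H) :
    centralComm hc (α x) (α y) = centralComm hc x y := by
  apply Subtype.ext
  rw [← hα (centralComm hc x y)]
  simp only [coe_centralComm, map_mul, map_inv]

/-- A character `φ` of the center makes the commutator pairing nondegenerate. -/
def NondegenerateOnCommutators (φ : center H →* ℂˣ) : Prop :=
  ∀ x : H, (∀ y, φ (centralComm hc x y) = 1) → x ∈ center H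

end CentralCommutator

/-! ### Baer's abelian twist of a class-two group. -/

section Baer

open Subgroup
open scoped IsMulCommutative

/-- A copy of the group `H`, carrying the abelian multiplication `x ∘ y = x y [x, y]^{-1/2}`. -/
def BaerTwist (H : Type*) := H

variable {H : Type*} [Group H] (hc : commutator H ≤ center H)

/-- The twisted multiplication `x ∘ y = x y [x, y]^{-s}`. -/
def baerMul (s : ℕ) (x y : H) : H := x * y * ((centralComm hc x y ^ s)⁻¹ : center H)

theorem baerMul_coe_right (s : ℕ) (x : H) (z : center H) : baerMul hc s x z = x * z := by
  simp [baerMul, centralComm_coe_right]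

/-- By bilinearity both sides are xyw times ([x,y][x,w][y,w])^(-s), for any s. -/
theorem baerMul_assoc (s : ℕ) (x y w : H) :
    baerMul hc s (baerMul hc s x y) w = baerMul hc s x (baerMul hc s y w) := by
  unfold baerMul
  rw [centralComm_mul_left, centralComm_coe_left, mul_one, centralComm_mul_left,
    centralComm_mul_right, centralComm_coe_right, mul_one, centralComm_mul_right,
    mul_assoc (_ * _ : H) _ w, center_coe_mul_comm]
  simp only [mul_assoc, ← Subgroup.coe_mul]
  congr 4
  simp only [mul_pow, mul_inv]
  exact (mul_assoc _ _ _).symm.trans (mul_comm _ _)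

theorem baerMul_comm (s : ℕ) (hs : ∀ z : center H, z ^ (2 * s) = z) (x y : H) :
    baerMul hc s x y = baerMul hc s y x := by
  unfold baerMul
  rw [centralComm_swap hc x y, ← centralComm_mul_swap hc x y, center_coe_mul_comm, mul_assoc,
    ← Subgroup.coe_mul, inv_pow, inv_inv]
  congr 2
  rw [mul_inv_eq_iff_eq_mul, ← pow_add, ← two_mul, hs]

theorem baerMul_one (s : ℕ) (x : H) : baerMul hc s x 1 = x := by
  simpa using baerMul_coe_right hc s x 1

theorem baerMul_inv (s : ℕ) (x : H) : baerMul hc s x x⁻¹ = 1 := by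
  simp [baerMul, centralComm_inv_right]

/-- The abelian group structure `x ∘ y = x y [x, y]^{-s}` on a group of class at most two in
which the `s`-th power is a square root on the center. -/
@[reducible]
def baerCommGroup (s : ℕ) (hs : ∀ z : center H, z ^ (2 * s) = z) : CommGroup (BaerTwist H) where
  mul x y := baerMul (H := H) hc s x y
  one := (1 : H)
  inv x := (Inv.inv (α := H) x)
  mul_assoc := baerMul_assoc hc s
  one_mul x := (baerMul_comm (H := H) hc s hs _ _).trans (baerMul_one (H := H) hc s x)
  mul_one := baerMul_one hc s
  inv_mul_cancel x := (baerMul_comm (H := H) hc s hs _ _).trans (baerMul_inv (H := H) hc s x)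
  mul_comm := baerMul_comm hc s hs

/-- In a finite group of class at most two with a square root `z ↦ z ^ s` on the center, a linear
character of the center extends to a character of the Baer-twisted group. -/
theorem exists_baer_extension [Finite H] (s : ℕ) (hs : ∀ z : center H, z ^ (2 * s) = z)
    (φ : center H →* ℂˣ) :
    ∃ f : H → ℂˣ, (∀ z : center H, f z = φ z) ∧
      ∀ x y, f (x * y) = f x * f y * φ (centralComm hc x y) ^ s := by
  let := baerCommGroup hc s hs
  have : Finite (BaerTwist H) := ‹Finite H›
  let ι : center H →* BaerTwist H :=
    { toFun := fun z => (z : H)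
      map_one' := rfl
      map_mul' := fun z w => (baerMul_coe_right hc s z w).symm }
  have hι : Function.Injective ι := fun z w h => Subtype.ext h
  let e := MonoidHom.ofInjective hι
  obtain ⟨F, hF⟩ := MonoidHom.domRestrict_surjective (G := BaerTwist H) ℂ ι.range
    (φ.comp e.symm.toMonoidHom)
  have hFz (z : center H) : F (ι z) = φ z := by
    have := DFunLike.congr_fun hF (e z)
    simpa using! this
  let f : H → ℂˣ := F
  have hf (x y : H) : f (baerMul hc s x y) = f x * f y :=
    MonoidHom.map_mul F x y
  have hfz (z : center H) : f z = φ z := hFz z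
  refine ⟨f, hfz, fun x y => ?_⟩
  have hxy : x * y = baerMul hc s (baerMul hc s x y) (centralComm hc x y ^ s : center H) := by
    rw [baerMul_coe_right]; simp [baerMul]
  calc f (x * y) = f x * f y * f (centralComm hc x y ^ s : center H) := by
        rw [← hf, ← hf, ← hxy]
    _ = _ := by rw [hfz, map_pow]

end Baer

/-! ### Duality for the pairing and conjugacy of Baer extensions. -/

section Splitting

open Subgroup
open scoped IsMulCommutative

variable {H : Type*} [Group H] (hc : commutator H ≤ center H)

/-- The commutator pairing `n ↦ (x ↦ φ [n, x])`, with values in characters modulo the center. -/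
def commPairing (φ : center H →* ℂˣ) : H →* (H ⧸ center H →* ℂˣ) where
  toFun n := QuotientGroup.lift (center H)
    { toFun := fun x => φ (centralComm hc n x)
      map_one' := by
        have := centralComm_coe_right hc n 1
        rw [Subgroup.coe_one] at this
        rw [this, map_one]
      map_mul' := fun x y => by rw [centralComm_mul_right, map_mul] }
    (fun z hz => by
      have := centralComm_coe_right hc n ⟨z, hz⟩
      simp only [MonoidHom.mem_ker, MonoidHom.coe_mk, OneHom.coe_mk]
      rw [this, map_one])
  map_one' := by
    ext x
    have := centralComm_coe_left hc x 1
    rw [Subgroup.coe_one] at this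
    simp [this]
  map_mul' m n := by
    ext x
    simp [centralComm_mul_left]

theorem commPairing_apply_mk (φ : center H →* ℂˣ) (n x : H) :
    commPairing hc φ n (x : H ⧸ center H) = φ (centralComm hc n x) := rfl

/-- Every character of `H` that is trivial on the center is of the form `x ↦ φ [n, x]` if `φ` is
nondegenerate. -/
theorem commPairing_surjective [Finite H] (φ : center H →* ℂˣ)
    (hφ : NondegenerateOnCommutators hc φ) : Function.Surjective (commPairing hc φ) := by
  let : CommGroup (H ⧸ center H) :=
    { (inferInstance : Group (H ⧸ center H)) with
      mul_comm := (Subgroup.Normal.quotient_commutative_iff_commutator_le).2 hc |>.is_comm.comm }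
  have hker : (commPairing hc φ).ker = center H := by
    ext n
    refine ⟨fun hn => hφ n fun y => ?_, fun hn => ?_⟩
    · rw [← commPairing_apply_mk, MonoidHom.mem_ker.1 hn, MonoidHom.one_apply]
    · refine MonoidHom.mem_ker.2 (QuotientGroup.monoidHom_ext _ (MonoidHom.ext fun x => ?_))
      change φ (centralComm hc n x) = 1
      rw [centralComm_coe_left hc x ⟨n, hn⟩, map_one]
  have : Finite (H ⧸ center H →* ℂˣ) :=
    Nat.finite_of_card_ne_zero (by
      rw [CommGroup.card_monoidHom_of_hasEnoughRootsOfUnity (H ⧸ center H) ℂ]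
      exact Nat.card_pos.ne')
  rw [← MonoidHom.range_eq_top]
  -- The range has order |H : Z(H)|, which is also the number of characters of the abelian group
  -- H/Z(H).
  apply Subgroup.eq_top_of_card_eq
  rw [← Subgroup.index_ker, hker, Subgroup.index]
  exact (CommGroup.card_monoidHom_of_hasEnoughRootsOfUnity (H ⧸ center H) ℂ).symm

variable {hc} {s : ℕ} {φ : center H →* ℂˣ} {f : H → ℂˣ}

theorem baer_extension_conj (hfz : ∀ z : center H, f z = φ z)
    (hf : ∀ x y, f (x * y) = f x * f y * φ (centralComm hc x y) ^ s) (n x : H) :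
    f (n * x * n⁻¹) = φ (centralComm hc n x) * f x := by
  have : n * x * n⁻¹ = centralComm hc n x * x := by rw [coe_centralComm]; group
  rw [this, hf, centralComm_coe_left, hfz]; simp

/-- Automorphisms that are trivial on the center permute the Baer extensions of `φ` in the same
way as inner automorphisms do. -/
theorem exists_conj_eq_baer_extension [Finite H] (hφ : NondegenerateOnCommutators hc φ)
    (hfz : ∀ z : center H, f z = φ z)
    (hf : ∀ x y, f (x * y) = f x * f y * φ (centralComm hc x y) ^ s)
    (α : MulAut H) (hα : ∀ z : center H, α z = z) :
    ∃ n : H, ∀ x, f (α x) = f (n * x * n⁻¹) := by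
  have hf1 : f 1 = 1 := by simpa using hfz 1
  -- `α` fixes commutators, so `f ∘ α` and `f` fail to be multiplicative by the same factor, which
  -- cancels in the quotient.
  let χ : H →* ℂˣ :=
    { toFun := fun x => f (α x) / f x
      map_one' := by simp
      map_mul' := fun x y => by
        rw [map_mul, hf, hf x y, centralComm_apply_mulAut hc α hα, mul_div_mul_right_eq_div,
          mul_div_mul_comm] }
  obtain ⟨n, hn⟩ := commPairing_surjective hc φ hφ
    (QuotientGroup.lift (center H) χ fun z hz => by
      change f (α z) / f z = 1
      rw [hα ⟨z, hz⟩, div_self'])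
  refine ⟨n, fun x => ?_⟩
  have := DFunLike.congr_fun hn (x : H ⧸ center H)
  rw [commPairing_apply_mk, QuotientGroup.lift_mk] at this
  rw [baer_extension_conj hfz hf, this]
  exact (div_mul_cancel _ _).symm

end Splitting

/-! ### Irreducible representations and their characters. -/

section Characters

theorem Representation.exists_irreducible_le {H V : Type*} [Group H] [AddCommGroup V] [Module ℂ V]
    [FiniteDimensional ℂ V] {ρ : Representation ℂ H V} (W : Subrepresentation ρ) (hW : W ≠ ⊥) :
    ∃ σ : Subrepresentation ρ, σ ≤ W ∧ σ.toRepresentation.IsIrreducible := by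
  obtain ⟨σ, ⟨hσW, hσ⟩, hmin⟩ := (InvImage.wf (Subrepresentation.toSubmodule (ρ := ρ))
    (wellFounded_lt (α := Submodule ℂ V))).has_min {σ | σ ≤ W ∧ σ ≠ ⊥} ⟨W, le_rfl, hW⟩
  refine ⟨σ, hσW, ?_⟩
  have hne : σ.toSubmodule ≠ ⊥ := fun h => hσ (Subrepresentation.toSubmodule_injective h)
  obtain ⟨v, hv, hv0⟩ := Submodule.exists_mem_ne_zero_of_ne_bot hne
  refine { exists_pair_ne := ⟨⊥, ⊤, fun h => hv0 ?_⟩, eq_bot_or_eq_top := fun τ => ?_ }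
  · have : (⟨v, hv⟩ : σ.toSubmodule) ∈ (⊥ : Subrepresentation σ.toRepresentation).toSubmodule := by
      rw [h]; exact Submodule.mem_top
    exact congrArg Subtype.val ((Submodule.mem_bot ℂ).1 this)
  · by_cases hτ : τ = ⊥
    · exact Or.inl hτ
    right
    let τ' : Subrepresentation ρ :=
      ⟨τ.toSubmodule.map σ.toSubmodule.subtype, by
        rintro g _ ⟨w, hw, rfl⟩
        exact ⟨σ.toRepresentation g w, τ.apply_mem_toSubmodule g hw, rfl⟩⟩
    have hle : τ'.toSubmodule ≤ σ.toSubmodule := Submodule.map_subtype_le _ _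
    have hτ' : τ' ≠ ⊥ := by
      intro h
      apply hτ
      apply Subrepresentation.toSubmodule_injective
      have h2 : τ.toSubmodule.map σ.toSubmodule.subtype = ⊥ :=
        congrArg Subrepresentation.toSubmodule h
      exact Submodule.map_injective_of_injective σ.toSubmodule.injective_subtype
        (h2.trans (Submodule.map_bot _).symm)
    have heq : τ'.toSubmodule = σ.toSubmodule := by
      by_contra hn
      exact hmin τ' ⟨le_trans hle hσW, hτ'⟩ (lt_of_le_of_ne hle hn)
    apply Subrepresentation.toSubmodule_injective
    apply Submodule.map_injective_of_injective σ.toSubmodule.injective_subtype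
    exact heq.trans (Submodule.map_subtype_top _).symm

theorem IsIrrChar.of_isIrreducible {H V : Type*} [Group H] [AddCommGroup V] [Module ℂ V]
    [FiniteDimensional ℂ V] (ρ : Representation ℂ H V) [hρ : ρ.IsIrreducible] :
    IsIrrChar ρ.character := by
  let e : V ≃ₗ[ℂ] (Fin (Module.finrank ℂ V) → ℂ) := (Module.finBasis ℂ V).equivFun
  let ρ' : Representation ℂ H (Fin (Module.finrank ℂ V) → ℂ) :=
    { toFun := fun g => e.conj (ρ g)
      map_one' := by rw [map_one]; exact e.conj_id
      map_mul' := fun g h => by rw [map_mul]; exact e.conj_comp _ _ }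
  have happ (g : H) (v : V) : ρ' g (e v) = e (ρ g v) := by
    change e.conj (ρ g) (e v) = _
    simp [LinearEquiv.conj_apply]
  refine ⟨_, ρ', ?_, funext fun g => LinearMap.trace_conj' (ρ g) e⟩
  let E : Subrepresentation ρ ≃o Subrepresentation ρ' :=
    { toFun := fun σ => ⟨σ.toSubmodule.map e.toLinearMap, by
        rintro g _ ⟨v, hv, rfl⟩
        exact ⟨ρ g v, σ.apply_mem_toSubmodule g hv, (happ g v).symm⟩⟩
      invFun := fun τ => ⟨τ.toSubmodule.comap e.toLinearMap, fun g v hv => by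
        have := τ.apply_mem_toSubmodule g hv
        rw [Submodule.mem_comap]
        exact (happ g v) ▸ this⟩
      left_inv := fun σ => Subrepresentation.toSubmodule_injective
        (Submodule.comap_map_eq_of_injective e.injective _)
      right_inv := fun τ => Subrepresentation.toSubmodule_injective
        (Submodule.map_comap_eq_of_surjective e.surjective _)
      map_rel_iff' := Submodule.map_le_map_iff_of_injective e.injective _ _ }
  exact E.symm.isSimpleOrder_iff.2 hρ

/-- An irreducible complex character of a commutative group is a homomorphism to `ℂˣ`. -/
theorem IsIrrChar.exists_monoidHom {H : Type*} [Group H] [IsMulCommutative H] {χ : H → ℂ}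
    (hχ : IsIrrChar χ) :
    ∃ ψ : H →* ℂˣ, ∀ z, χ z = ψ z := by
  obtain ⟨n, ρ, hρ, rfl⟩ := hχ
  have h1 : Module.finrank ℂ (Fin n → ℂ) = 1 :=
    Representation.IsIrreducible.finrank_eq_one_of_isMulCommutative ρ
  have hsc (T : Module.End ℂ (Fin n → ℂ)) : T = LinearMap.trace ℂ _ T • 1 := by
    obtain ⟨v, hv0, hv⟩ := finrank_eq_one_iff'.1 h1
    obtain ⟨c, hcv⟩ := hv (T v)
    have hT : T = c • 1 := by
      refine LinearMap.ext fun w => ?_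
      obtain ⟨a, rfl⟩ := hv w
      rw [map_smul, ← hcv, LinearMap.smul_apply, Module.End.one_apply, smul_comm]
    rw [hT, map_smul, LinearMap.trace_one, h1]; simp
  let ψ : H →* ℂ :=
    { toFun := ρ.character
      map_one' := by rw [Representation.char_one, h1]; simp
      map_mul' := fun x y => by
        simp only [Representation.character]
        rw [map_mul, hsc (ρ x)]
        simp [LinearMap.trace_one, h1] }
  exact ⟨ψ.toHomUnits, fun z => rfl⟩

end Characters

/-! ### Full ramification over the center. -/

section FullyRamified

open Subgroup

variable {H : Type*} [Group H]

/-- The right regular representation on complex functions. -/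
def rightRegular (H : Type*) [Group H] : Representation ℂ H (H → ℂ) where
  toFun g := LinearMap.funLeft ℂ ℂ (· * g)
  map_one' := by ext; simp
  map_mul' g h := by
    apply LinearMap.ext; intro f; funext x
    simp [LinearMap.funLeft_apply, mul_assoc]

/-- The functions on `H` on which the center acts through `φ`. -/
def centralFunctions (φ : center H →* ℂˣ) : Subrepresentation (rightRegular H) where
  toSubmodule :=
    { carrier := {f | ∀ (z : center H) (x : H), f (x * z) = φ z * f x}
      add_mem' := fun ha hb z x => by simp only [Pi.add_apply, ha z x, hb z x, mul_add]
      zero_mem' := fun z x => by simp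
      smul_mem' := fun c f hf z x => by
        simp only [Pi.smul_apply, smul_eq_mul, hf z x]; ring }
  apply_mem_toSubmodule g f hf z x := by
    change f (x * z * g) = φ z * f (x * g)
    rw [← hf z (x * g), mul_assoc, mul_assoc, mem_center_iff.1 z.2 g]

theorem centralFunctions_ne_bot (φ : center H →* ℂˣ) : centralFunctions φ ≠ ⊥ := by
  classical
  intro h
  let f : H → ℂ := fun x => if hx : x ∈ center H then φ ⟨x, hx⟩ else 0
  have hf : f ∈ (centralFunctions φ).toSubmodule := by
    intro z x
    by_cases hx : x ∈ center H
    · have hxz : x * z ∈ center H := mul_mem hx z.2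
      simp only [f, dif_pos hx, dif_pos hxz]
      rw [← Units.val_mul, ← map_mul]
      congr 2
      apply Subtype.ext
      exact (mem_center_iff.1 z.2 x)
    · have hxz : ¬ x * z ∈ center H := fun hm => hx (by
        simpa using mul_mem hm (inv_mem z.2))
      simp only [f, dif_neg hx, dif_neg hxz, mul_zero]
  rw [h] at hf
  have := congrFun ((Submodule.mem_bot ℂ).1 hf) 1
  simp only [f, dif_pos (one_mem (center H)), Pi.zero_apply] at this
  exact (φ ⟨1, one_mem _⟩).ne_zero this

/-- A linear character of the center lies under an irreducible representation. -/
theorem exists_irreducible_over_center [Finite H] (φ : center H →* ℂˣ) :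
    ∃ σ : Subrepresentation (rightRegular H), σ.toRepresentation.IsIrreducible ∧
      ∀ z : center H, σ.toRepresentation z = (φ z : ℂ) • 1 := by
  obtain ⟨σ, hσ, hirr⟩ := Representation.exists_irreducible_le _ (centralFunctions_ne_bot φ)
  refine ⟨σ, hirr, fun z => ?_⟩
  ext1 v
  apply Subtype.ext
  funext x
  exact hσ v.2 z x

theorem inducedClassFun_center_of_mem [Finite H] (φ : center H → ℂ) (z : center H) :
    inducedClassFun (center H) φ z = (center H).index * φ z := by
  classical
  have hconj (x : H) : x⁻¹ * z * x = z := by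
    rw [mul_assoc, ← mem_center_iff.1 z.2 x, inv_mul_cancel_left]
  have hterm (x : H) : (if h : x⁻¹ * z * x ∈ center H then φ ⟨x⁻¹ * z * x, h⟩ else 0) = φ z := by
    have hm : x⁻¹ * z * x ∈ center H := by rw [hconj]; exact z.2
    rw [dif_pos hm]
    congr 1
    exact Subtype.ext (hconj x)
  have := Fintype.ofFinite H
  have h0 : (Nat.card (center H) : ℂ) ≠ 0 := Nat.cast_ne_zero.2 Nat.card_pos.ne'
  unfold inducedClassFun
  rw [finsum_congr (g := fun _ => φ z) (fun x => by convert hterm x), finsum_eq_sum_of_fintype,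
    Finset.sum_const, Finset.card_univ, Fintype.card_eq_nat_card, ← (center H).card_mul_index]
  simp only [nsmul_eq_mul, Nat.cast_mul]
  field_simp

theorem inducedClassFun_center_of_notMem [Finite H] (φ : center H → ℂ) {g : H}
    (hg : g ∉ center H) : inducedClassFun (center H) φ g = 0 := by
  unfold inducedClassFun
  have hterm (x : H) : ¬ x⁻¹ * g * x ∈ center H := fun h => hg (by
    have := (inferInstance : (center H).Normal).conj_mem _ h x
    simpa [mul_assoc] using this)
  rw [finsum_congr (g := fun _ => 0) (fun x => dif_neg (hterm x)), finsum_zero, mul_zero]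

/-- A linear character of the center is fully ramified if every noncentral element has a
conjugate `z g` with `z` central and `φ z ≠ 1`. -/
theorem isFullyRamified_center [Finite H] (φ : center H →* ℂˣ)
    (hφ : ∀ g ∉ center H, ∃ (y : H) (z : center H), y * g * y⁻¹ = z * g ∧ φ z ≠ 1) :
    IsFullyRamified (center H) (fun z => (φ z : ℂ)) := by
  classical
  obtain ⟨σ, hirr, hz⟩ := exists_irreducible_over_center φ
  set ρ := σ.toRepresentation
  have := Fintype.ofFinite H
  have hcard : (Nat.card H : ℂ) ≠ 0 := Nat.cast_ne_zero.2 Nat.card_pos.ne'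
  have := invertibleOfNonzero hcard
  set d := Module.finrank ℂ σ.toSubmodule
  have hmem (z : center H) : ρ.character z = d * φ z := by
    rw [Representation.character, hz, map_smul, LinearMap.trace_one, smul_eq_mul, mul_comm]
  have hnot (g : H) (hg : g ∉ center H) : ρ.character g = 0 := by
    obtain ⟨y, z, hyz, hne⟩ := hφ g hg
    -- The character agrees at g and zg, yet is scaled by φ(z) ≠ 1, so it is zero at g.
    have h1 := ρ.char_conj g y
    have h2 : ρ.character (z * g) = φ z * ρ.character g := by
      rw [Representation.character, map_mul, hz, smul_one_mul, map_smul, smul_eq_mul,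
        Representation.character]
    rw [hyz, h2] at h1
    by_contra h0
    exact hne (Units.ext (by simpa [h0] using h1))
  have horth := Representation.char_orthonormal ρ ρ
  rw [if_pos ⟨Representation.Equiv.refl ρ⟩] at horth
  have hsum : ∑ g : H, ρ.character g * ρ.character g⁻¹ = Nat.card (center H) * (d : ℂ) ^ 2 := by
    have hterm (g : H) : ρ.character g * ρ.character g⁻¹ =
        if g ∈ center H then (d : ℂ) ^ 2 else 0 := by
      split_ifs with hg
      · have e1 := hmem ⟨g, hg⟩
        have e2 := hmem (⟨g, hg⟩⁻¹)
        rw [map_inv] at e2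
        simp only [Subgroup.coe_inv] at e1 e2
        rw [e1, e2]
        have : ((φ ⟨g, hg⟩ : ℂˣ) : ℂ) * ((φ ⟨g, hg⟩)⁻¹ : ℂˣ) = 1 := Units.mul_inv _
        linear_combination (d : ℂ) ^ 2 * this
      · rw [hnot g hg, zero_mul]
    rw [Finset.sum_congr rfl fun g _ => hterm g, ← Finset.sum_filter, Finset.sum_const,
      nsmul_eq_mul, Nat.card_eq_fintype_card, Fintype.card_subtype]
  -- Norm one, with support in the center, reads |Z(H)| d² = |H|.
  have hd : d ^ 2 = (center H).index := by
    rw [hsum, inv_mul_eq_iff_eq_mul₀ hcard, ← (center H).card_mul_index] at horth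
    have h2 : Nat.card (center H) * d ^ 2 = Nat.card (center H) * (center H).index := by
      apply Nat.cast_injective (R := ℂ)
      push_cast at horth ⊢
      simpa using horth
    exact Nat.eq_of_mul_eq_mul_left Nat.card_pos h2
  refine ⟨d, ρ.character, IsIrrChar.of_isIrreducible ρ, hd, fun g => ?_⟩
  by_cases hg : g ∈ center H
  · have e1 := hmem ⟨g, hg⟩
    rw [show g = ((⟨g, hg⟩ : center H) : H) from rfl, inducedClassFun_center_of_mem, e1, ← hd]
    push_cast; ring
  · rw [inducedClassFun_center_of_notMem _ hg, hnot g hg, mul_zero]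

end FullyRamified

/-! ### Consequences of minimality, and the supplement. -/

section MinimalNoncentral

open Subgroup

theorem mem_center_of_coe_mem_center {G : Type*} [Group G] {N : Subgroup G} {x : N}
    (hx : (x : G) ∈ center G) : x ∈ center N :=
  mem_center_iff.2 fun y => Subtype.ext (mem_center_iff.1 hx y)

theorem isFullyRamified_of_nondegenerate {H : Type*} [Group H] [Finite H]
    (hc : commutator H ≤ center H) (φ : center H →* ℂˣ)
    (hφ : NondegenerateOnCommutators hc φ) :
    IsFullyRamified (center H) (fun z => (φ z : ℂ)) := by
  refine isFullyRamified_center φ fun g hg => ?_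
  by_contra! h
  refine hg (hφ g fun y => ?_)
  rw [centralComm_swap, map_inv, h y (centralComm hc y g) (by rw [coe_centralComm]; group),
    inv_one]

theorem splitsOver_of_supplement {G : Type*} [Group G] {N : Subgroup G}
    (Z : Subgroup G) [Z.Normal] (S : Subgroup G) (hS : S ⊓ N = Z)
    (hsup : ∀ g : G, ∃ n ∈ N, ∃ t ∈ S, n * t = g) :
    SplitsOver (N.map (QuotientGroup.mk' Z)) := by
  refine ⟨S.map (QuotientGroup.mk' Z), isComplement'_of_disjoint_and_mul_eq_univ ?_ ?_⟩
  · rw [disjoint_def]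
    rintro _ ⟨n, hn, rfl⟩ ⟨t, ht, htn⟩
    have hZ : t⁻¹ * n ∈ Z := QuotientGroup.eq.1 htn
    have hnS : n ∈ S := by
      have := S.mul_mem ht (hS.ge hZ).1
      rwa [mul_inv_cancel_left] at this
    exact (QuotientGroup.eq_one_iff n).2 (hS.le ⟨hnS, hn⟩)
  · refine Set.eq_univ_of_forall fun q => ?_
    obtain ⟨g, rfl⟩ := QuotientGroup.mk'_surjective Z q
    obtain ⟨n, hn, t, ht, rfl⟩ := hsup g
    exact ⟨_, ⟨n, hn, rfl⟩, _, ⟨t, ht, rfl⟩, (map_mul _ _ _).symm⟩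

open scoped IsMulCommutative in
theorem exists_center_character_ne_one {H : Type*} [Group H] [Finite H]
    (hna : ¬ ∀ x y : H, x * y = y * x) (hc : commutator H ≤ center H) :
    ∃ (φ : center H →* ℂˣ) (z : center H), (z : H) ∈ commutator H ∧ φ z ≠ 1 := by
  push Not at hna
  obtain ⟨x, y, hxy⟩ := hna
  obtain ⟨φ, hφ⟩ := CommGroup.exists_apply_ne_one_of_hasEnoughRootsOfUnity (center H) ℂ
    (a := centralComm hc x y) (fun h => hxy (by
      rw [← centralComm_mul_swap hc, h, Subgroup.coe_one, one_mul]))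
  exact ⟨φ, centralComm hc x y, commutator_mem_commutator (mem_top x) (mem_top y), hφ⟩

variable {G : Type*} [Group G] {N : Subgroup G} [N.Normal]

theorem le_center_or_eq_top_of_minimal
    (hmin : Minimal (fun M : Subgroup G => M.Normal ∧ ¬ M ≤ center G) N)
    (K : Subgroup N) (hK : ∀ (g : G), ∀ x ∈ K, MulAut.conjNormal g x ∈ K) :
    K.map N.subtype ≤ center G ∨ K = ⊤ := by
  by_contra! h
  have hn : (K.map N.subtype).Normal := ⟨by
    rintro _ ⟨x, hx, rfl⟩ g
    exact ⟨_, hK g x hx, MulAut.conjNormal_apply g x⟩⟩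
  have hle := hmin.2 ⟨hn, h.1⟩ (map_subtype_le K)
  refine h.2 (eq_top_iff.2 fun x _ => ?_)
  obtain ⟨y, hy, hyx⟩ := hle x.2
  rwa [← Subtype.ext hyx]

theorem map_center_le_center_of_minimal (hna : ¬ ∀ x y : N, x * y = y * x)
    (hmin : Minimal (fun M : Subgroup G => M.Normal ∧ ¬ M ≤ center G) N) :
    (center N).map N.subtype ≤ center G := by
  refine (le_center_or_eq_top_of_minimal hmin (center N) fun g x hx => ?_).resolve_right
    fun h => hna fun x y => ?_
  · exact (Characteristic.fixed (H := center N) inferInstance (MulAut.conjNormal g)).ge hx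
  · exact (mem_center_iff.1 (h ▸ mem_top y : y ∈ center N) x)

/-- A nontrivial nilpotent group has a proper derived subgroup, so minimality makes it central. -/
theorem commutator_le_center_of_minimal [Finite G] {p : ℕ} (hp : p.Prime) (hpN : IsPGroup p N)
    (hna : ¬ ∀ x y : N, x * y = y * x)
    (hmin : Minimal (fun M : Subgroup G => M.Normal ∧ ¬ M ≤ center G) N) :
    commutator N ≤ center N := by
  have := Fact.mk hp
  have := hpN.isNilpotent
  have : Nontrivial N := by
    by_contra h
    have := not_nontrivial_iff_subsingleton.1 h
    exact hna fun x y => Subsingleton.elim _ _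
  have h := (le_center_or_eq_top_of_minimal hmin (commutator N) fun g x hx =>
    (Characteristic.fixed (H := commutator N) inferInstance (MulAut.conjNormal g)).ge hx).resolve_right
      (Group.IsSolvable.commutator_lt_top_of_nontrivial N).ne
  exact fun x hx => mem_center_of_coe_mem_center (h ⟨x, hx, rfl⟩)

theorem conjNormal_apply_center (hz : (center N).map N.subtype ≤ center G) (g : G)
    (z : center N) : MulAut.conjNormal g (z : N) = z := by
  apply Subtype.ext
  have h : ((z : N) : G) ∈ center G := hz ⟨z, z.2, rfl⟩
  rw [MulAut.conjNormal_apply, mem_center_iff.1 h g, mul_inv_cancel_right]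

theorem nondegenerateOnCommutators_of_minimal
    (hmin : Minimal (fun M : Subgroup G => M.Normal ∧ ¬ M ≤ center G) N)
    (hz : (center N).map N.subtype ≤ center G) (hc : commutator N ≤ center N)
    (φ : center N →* ℂˣ) (hφ : ∃ z : center N, (z : N) ∈ commutator N ∧ φ z ≠ 1) :
    NondegenerateOnCommutators hc φ := by
  have hker (x : N) : x ∈ (commPairing hc φ).ker ↔ ∀ y, φ (centralComm hc x y) = 1 := by
    refine ⟨fun hx y => ?_, fun hx => MonoidHom.mem_ker.2
      (QuotientGroup.monoidHom_ext _ (MonoidHom.ext fun y => hx y))⟩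
    rw [← commPairing_apply_mk, MonoidHom.mem_ker.1 hx, MonoidHom.one_apply]
  rcases le_center_or_eq_top_of_minimal hmin (commPairing hc φ).ker fun g x hx => by
    rw [hker] at hx ⊢
    intro y
    have := centralComm_apply_mulAut hc (MulAut.conjNormal g) (conjNormal_apply_center hz g) x
      ((MulAut.conjNormal g).symm y)
    rw [MulEquiv.apply_symm_apply] at this
    rw [this]
    exact hx _ with h | h
  · exact fun x hx => mem_center_of_coe_mem_center (h ⟨x, (hker x).2 hx, rfl⟩)
  -- If the radical were all of N, φ would be trivial on every commutator, hence on [N,N].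
  · obtain ⟨z, hzc, hne⟩ := hφ
    have hle : commutator N ≤ (φ.ker).map (center N).subtype := by
      rw [commutator_eq_closure, closure_le]
      rintro _ ⟨x, y, rfl⟩
      exact ⟨centralComm hc x y, MonoidHom.mem_ker.2 ((hker x).1 (h ▸ mem_top x) y), rfl⟩
    obtain ⟨w, hw, hwz⟩ := hle hzc
    rw [← Subtype.ext hwz] at hne
    exact absurd (MonoidHom.mem_ker.1 hw) hne

/-- If `φ` is nondegenerate on commutators of `N`, the order of `N` is odd and `G` centralizes
`Z(N)`, then the stabilizer in `G` of a Baer extension of `φ` is a supplement of `N` that meets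
`N` in `Z(N)`. -/
theorem exists_supplement_of_nondegenerate [Finite G]
    (hz : (center N).map N.subtype ≤ center G) (hc : commutator N ≤ center N)
    (hodd : Odd (Nat.card N)) (φ : center N →* ℂˣ) (hφ : NondegenerateOnCommutators hc φ) :
    ∃ S : Subgroup G, S ⊓ N = (center N).map N.subtype ∧ ∀ g : G, ∃ n ∈ N, ∃ t ∈ S, n * t = g := by
  obtain ⟨k, hk⟩ := hodd
  -- With |N| = 2k + 1, the exponent k + 1 halves: 2(k + 1) = |N| + 1.
  obtain ⟨f, hfz, hf⟩ := exists_baer_extension hc (k + 1) (fun z => by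
    rw [show 2 * (k + 1) = Nat.card N + 1 by omega, pow_succ]
    have : z ^ Nat.card N = 1 := Subtype.ext (by
      rw [Subgroup.coe_pow, pow_card_eq_one', Subgroup.coe_one])
    rw [this, one_mul]) φ
  let S : Subgroup G :=
    { carrier := {g | ∀ x : N, f (MulAut.conjNormal g x) = f x}
      mul_mem' := fun {a b} ha hb x => by
        rw [map_mul, MulAut.mul_apply, ha, hb]
      one_mem' := fun x => by rw [map_one, MulAut.one_apply]
      inv_mem' := fun {a} ha x => by
        rw [← ha, ← MulAut.mul_apply, ← map_mul, mul_inv_cancel, map_one, MulAut.one_apply] }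
  have hconj (n x : N) : MulAut.conjNormal (n : G) x = n * x * n⁻¹ :=
    Subtype.ext (MulAut.conjNormal_apply _ _)
  refine ⟨S, le_antisymm ?_ ?_, fun g => ?_⟩
  · rintro n ⟨hnS, hnN⟩
    refine ⟨⟨n, hnN⟩, hφ _ fun x => ?_, rfl⟩
    have h := hnS x
    rw [hconj ⟨n, hnN⟩, baer_extension_conj hfz hf] at h
    exact mul_eq_right.1 h
  · rintro _ ⟨z, hzz, rfl⟩
    refine ⟨fun x => ?_, z.2⟩
    have := baer_extension_conj hfz hf z x
    rw [centralComm_coe_left hc x ⟨z, hzz⟩, map_one, one_mul, ← hconj] at this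
    exact this
  -- Since g⁻¹ and n move f alike, n g fixes f, and g = n⁻¹(n g).
  · obtain ⟨n, hn⟩ := exists_conj_eq_baer_extension hφ hfz hf (MulAut.conjNormal g⁻¹)
      (conjNormal_apply_center hz _)
    refine ⟨(n⁻¹ : N), (n⁻¹).2, n * g, fun x => ?_, by simp⟩
    rw [map_mul, MulAut.mul_apply, hconj, ← hn, ← MulAut.mul_apply, ← map_mul, inv_mul_cancel,
      map_one, MulAut.one_apply]

end MinimalNoncentral

theorem proposition2p1 {G : Type*} [Group G] [Finite G] (p : ℕ) (hp : p.Prime)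
    (N : Subgroup G) [N.Normal] (hpN : IsPGroup p N)
    (hna : ¬ ∀ x y : N, x * y = y * x)
    (hmin : Minimal (fun M : Subgroup G => M.Normal ∧ ¬ M ≤ Subgroup.center G) N) :
    (commutator N ≤ Subgroup.center N ∧
      ∀ φ : Subgroup.center N → ℂ, IsIrrChar φ →
        (∃ z : Subgroup.center N, (z : N) ∈ commutator N ∧ φ z ≠ 1) →
        IsFullyRamified (Subgroup.center N) φ) ∧
    (2 < p →
      SplitsOver
        (N.map (QuotientGroup.mk' ((Subgroup.center N).map N.subtype))) ∧
      ¬ N ≤ frattini G) := by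
  have hc := commutator_le_center_of_minimal hp hpN hna hmin
  have hz := map_center_le_center_of_minimal hna hmin
  refine ⟨⟨hc, fun φ hφ hne => ?_⟩, fun hp2 => ?_⟩
  · obtain ⟨ψ, hψ⟩ := hφ.exists_monoidHom
    obtain rfl : φ = fun z => (ψ z : ℂ) := funext hψ
    obtain ⟨z, hzc, hzne⟩ := hne
    refine isFullyRamified_of_nondegenerate hc ψ
      (nondegenerateOnCommutators_of_minimal hmin hz hc ψ ⟨z, hzc, fun h => hzne ?_⟩)
    simp [h]
  · obtain ⟨φ, hφ⟩ := exists_center_character_ne_one hna hc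
    have := Fact.mk hp
    have hodd : Odd (Nat.card N) := by
      obtain ⟨k, hk⟩ := IsPGroup.iff_card.1 hpN
      rw [hk]
      exact (hp.odd_of_ne_two (by omega)).pow
    obtain ⟨S, hS, hsup⟩ := exists_supplement_of_nondegenerate hz hc hodd φ
      (nondegenerateOnCommutators_of_minimal hmin hz hc φ hφ)
    refine ⟨splitsOver_of_supplement _ S hS hsup, fun hle => hmin.1.2 ?_⟩
    -- NS = G and N ≤ Φ(G) give SΦ(G) = G; the Frattini subgroup consists of nongenerators.
    have htop : S = ⊤ := frattini_nongenerating (eq_top_iff.2 fun g _ => by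
      obtain ⟨n, hn, t, ht, rfl⟩ := hsup g
      exact mul_mem (le_sup_right (a := S) (hle hn)) (le_sup_left (b := frattini G) ht))
    rw [htop, top_inf_eq] at hS
    exact hS ▸ hz
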